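/- Let $d\ge 1$ be an integer. There exist constants $0<c_d, C_d<\infty$, depending only on $d$, such that the following holds for every log-concave probability density $f:\mathbb{R}^d\to[0,\infty)$ that is centered. Here log-concave means that $f((1-t)x+ty)\ge f(x)^{1-t}f(y)^t$ for all $x,y\in\mathbb{R}^d$ and $t\in(0,1)$, and centered means that $\int_{\mathbb{R}^d} x f(x)\,dx=0$. Then $\int_{\mathbb{R}^d}\|x\|_2^2f(x)\,dx<\infty$, and for every $\theta\in\mathbb{R}^d$ with $\|\theta\|_2=1$ the integral $\int_0^\infty r^{d-1}f(r\theta)\,dr$ is finite and $$c_d\, f(0)\,\Bigl(\sqrt{\lambda_{\min}(\mathrm{Cov}(f))}\Bigr)^{d}\ \le\ \int_0^\infty r^{d-1}f(r\theta)\,dr\ \le\ C_d\, f(0)\,\Bigl(\sqrt{\lambda_{\max}(\mathrm{Cov}(f))}\Bigr)^{d},$$ where $\mathrm{Cov}(f)$ is the $d\times d$ covariance matrix with entries $\frac{\int x_ix_jf(x)\,dx}{\int f(x)\,dx}-\frac{\int x_if(x)\,dx\,\int x_jf(x)\,dx}{(\int f(x)\,dx)^2}$ (integrals over $\mathbb{R}^d$),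 and $\lambda_{\min}$, $\lambda_{\max}$ denote its smallest and largest eigenvalues. -/

import Mathlib

open MeasureTheory

noncomputable section

/-- `f = exp (-V)` with `V` convex with values in `(-∞, +∞]`. Since `0 < t < 1` one has
`0 ^ t = 0`, so the inequality is trivial where `f` vanishes. -/
def IsLogConcave {d : ℕ} (f : EuclideanSpace ℝ (Fin d) → ℝ) : Prop :=
  (∀ x, 0 ≤ f x) ∧
    ∀ x y : EuclideanSpace ℝ (Fin d), ∀ t : ℝ, 0 < t → t < 1 →
      f x ^ (1 - t) * f y ^ t ≤ f ((1 - t) • x + t • y)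

/-- A probability density with respect to Lebesgue measure. -/
def IsProbDensity {d : ℕ} (f : EuclideanSpace ℝ (Fin d) → ℝ) : Prop :=
  (∀ x, 0 ≤ f x) ∧ Integrable f ∧ ∫ x, f x = 1

/-- The barycenter is the origin. (For a log-concave density the first moments are finite, so the
integrals are genuine.) -/
def IsCentered {d : ℕ} (f : EuclideanSpace ℝ (Fin d) → ℝ) : Prop :=
  ∀ i : Fin d, ∫ x, x i * f x = 0

/-- The covariance (inertia) matrix of a nonnegative function on `ℝ^d`. -/
def covMatrix {d : ℕ} (f : EuclideanSpace ℝ (Fin d) → ℝ) : Matrix (Fin d) (Fin d) ℝ :=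
  Matrix.of fun i j =>
    (∫ x, x i * x j * f x) / (∫ x, f x)
      - ((∫ x, x i * f x) * (∫ x, x j * f x)) / (∫ x, f x) ^ 2

/-- The largest real eigenvalue of a matrix. -/
def lambdaMax {d : ℕ} (A : Matrix (Fin d) (Fin d) ℝ) : ℝ := sSup (spectrum ℝ A)

/-- The smallest real eigenvalue of a matrix. -/
def lambdaMin {d : ℕ} (A : Matrix (Fin d) (Fin d) ℝ) : ℝ := sInf (spectrum ℝ A)

end

/-! Everything rests on the midpoint inequality `f y * f z ≤ f ((y + z) / 2) ^ 2`. If `f y ≤ B² f z`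
for all `y`, then `f y ≤ B f ((y + z) / 2)`, and averaging over `y` compares integrals against `f`
recentred at `z` with integrals against `f`, at the cost of `B * 2 ^ d`. This gives boundedness of
`f`, finite second moments, and a bound on `|⟪z, u⟫|` by the first absolute moment in direction `u`,
whenever `f z` is comparable to the maximum.

The same device shows that `f 0` is comparable to the maximum: otherwise a half-space bounded by a
hyperplane through `0` carries too little first moment for the barycenter to be `0`
(`le_mul_apply_zero_of_isCentered`).

Upper bound: the level set `{f ≥ f 0 / e}` has radius at most a constant times `√λ_max`, and beyond
it log-concavity forces exponential decay along rays (`apply_smul_le_mul_exp`).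

Lower bound: if `f x < f 0 / e`, separating `x` from that level set shows that `f` has dropped on a
half-space at distance of order `‖x‖`. Centering turns this one-sided information into a variance
bound of order `‖x‖²`, so `√λ_min` is at most a constant times `‖x‖`. Hence `f ≥ f 0 / e` on a ball
of radius a constant times `√λ_min` (`exp_neg_one_mul_le_of_le_sqrt_lambdaMin`). -/

/-! ### Pointwise consequences of log-concavity -/

theorem IsLogConcave.mul_le_sq_midpoint {d : ℕ} {f : EuclideanSpace ℝ (Fin d) → ℝ}
    (hf : IsLogConcave f) (x y : EuclideanSpace ℝ (Fin d)) :
    f x * f y ≤ f ((1 / 2 : ℝ) • (x + y)) ^ 2 := by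
  have h := hf.2 x y (1 / 2) (by norm_num) (by norm_num)
  rw [show (1 - 1 / 2 : ℝ) = 1 / 2 by norm_num, ← smul_add, ← Real.sqrt_eq_rpow,
    ← Real.sqrt_eq_rpow, ← Real.sqrt_mul (hf.1 x)] at h
  exact (Real.sqrt_le_left (hf.1 _)).1 h

theorem IsLogConcave.le_mul_midpoint {d : ℕ} {f : EuclideanSpace ℝ (Fin d) → ℝ}
    (hf : IsLogConcave f) {B : ℝ} (hB : 0 ≤ B) {y z : EuclideanSpace ℝ (Fin d)}
    (h : f y ≤ B ^ 2 * f z) : f y ≤ B * f ((1 / 2 : ℝ) • (y + z)) := by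
  refine abs_le_of_sq_le_sq' ?_ (mul_nonneg hB (hf.1 _)) |>.2
  have h1 := hf.mul_le_sq_midpoint y z
  nlinarith [mul_le_mul_of_nonneg_left h (hf.1 y), mul_le_mul_of_nonneg_left h1 (sq_nonneg B)]

theorem IsLogConcave.convex_superlevel {d : ℕ} {f : EuclideanSpace ℝ (Fin d) → ℝ}
    (hf : IsLogConcave f) {a : ℝ} (ha : 0 < a) : Convex ℝ {x | a ≤ f x} := by
  refine convex_iff_forall_pos.2 fun x hx y hy s t hs ht hst => ?_
  obtain rfl : s = 1 - t := by linarith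
  refine le_trans ?_ (hf.2 x y t ht (by linarith))
  calc a = a ^ (1 - t) * a ^ t := by rw [← Real.rpow_add ha]; simp
    _ ≤ f x ^ (1 - t) * f y ^ t :=
      mul_le_mul (Real.rpow_le_rpow ha.le hx hs.le) (Real.rpow_le_rpow ha.le hy ht.le)
        (by positivity) (Real.rpow_nonneg (hf.1 x) _)

/-- Once `f` has dropped by the factor `e` along a ray, it decays exponentially from there on. -/
theorem IsLogConcave.le_mul_exp_neg {d : ℕ} {f : EuclideanSpace ℝ (Fin d) → ℝ}
    (hf : IsLogConcave f) {x v : EuclideanSpace ℝ (Fin d)} (hx : 0 < f x) {s : ℝ} (hs : 1 ≤ s)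
    (h : f (x + v) ≤ Real.exp (-1) * f x) : f (x + s • v) ≤ f x * Real.exp (-s) := by
  have hs0 : 0 < s := by linarith
  rcases hs.eq_or_lt with rfl | hs1
  · simpa [mul_comm] using h
  -- `x + v` lies at fraction `s⁻¹` of the segment from `x` to `x + s • v`.
  have h1 := hf.2 x (x + s • v) s⁻¹ (by positivity) (inv_lt_one_of_one_lt₀ hs1)
  have e : (1 - s⁻¹) • x + s⁻¹ • (x + s • v) = x + v := by
    rw [smul_add, smul_smul, inv_mul_cancel₀ hs0.ne', sub_smul, one_smul, one_smul]; abel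
  rw [e] at h1
  have h2 := h1.trans h
  have h3 : f (x + s • v) ^ s⁻¹ ≤ (f x * Real.exp (-s)) ^ s⁻¹ := by
    rw [Real.mul_rpow hx.le (Real.exp_nonneg _), ← Real.exp_mul,
      show -s * s⁻¹ = -1 by field_simp]
    have hp : 0 < f x ^ (1 - s⁻¹) := Real.rpow_pos_of_pos hx _
    have e2 : f x = f x ^ (1 - s⁻¹) * f x ^ s⁻¹ := by rw [← Real.rpow_add hx]; simp
    refine le_of_mul_le_mul_left (a := f x ^ (1 - s⁻¹)) ?_ hp
    calc _ ≤ _ := h2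
      _ = _ := by nth_rewrite 1 [e2]; ring
  exact (Real.rpow_le_rpow_iff (hf.1 _) (by positivity) (by positivity)).1 h3

/-! ### Averaging over midpoints -/

section midpoint
variable {d : ℕ}

theorem integral_comp_midpoint (g : EuclideanSpace ℝ (Fin d) → ℝ)
    (z : EuclideanSpace ℝ (Fin d)) :
    ∫ y, g ((1 / 2 : ℝ) • (y + z)) = 2 ^ d * ∫ x, g x := by
  rw [integral_add_right_eq_self (fun y => g ((1 / 2 : ℝ) • y)) z,
    Measure.integral_comp_smul]
  simp

theorem Integrable.comp_midpoint {g : EuclideanSpace ℝ (Fin d) → ℝ} (hg : Integrable g)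
    (z : EuclideanSpace ℝ (Fin d)) : Integrable fun y => g ((1 / 2 : ℝ) • (y + z)) :=
  (hg.comp_smul (by norm_num : (1 / 2 : ℝ) ≠ 0)).comp_add_right z

/-- The main transfer tool: dominate `f y` by its value at the midpoint, then change variables; `2 ^
d` is the Jacobian of the halving map. -/
theorem setIntegral_comp_midpoint_mul_le {f φ : EuclideanSpace ℝ (Fin d) → ℝ}
    (hf : ∀ x, 0 ≤ f x) (hφ : ∀ x, 0 ≤ φ x) (hi : Integrable fun x => φ x * f x)
    {A : Set (EuclideanSpace ℝ (Fin d))} (hA : MeasurableSet A) {K : ℝ} (hK : 0 ≤ K)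
    (z : EuclideanSpace ℝ (Fin d)) (h : ∀ y ∈ A, f y ≤ K * f ((1 / 2 : ℝ) • (y + z))) :
    ∫ y in A, φ ((1 / 2 : ℝ) • (y + z)) * f y ≤ K * 2 ^ d * ∫ x, φ x * f x := by
  have hI := (Integrable.comp_midpoint hi z).const_mul K
  calc ∫ y in A, φ ((1 / 2 : ℝ) • (y + z)) * f y
      ≤ ∫ y in A, K * (φ ((1 / 2 : ℝ) • (y + z)) * f ((1 / 2 : ℝ) • (y + z))) := by
        refine integral_mono_of_nonneg (.of_forall fun y => mul_nonneg (hφ _) (hf _))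
          hI.integrableOn ?_
        refine (ae_restrict_iff' hA).2 (.of_forall fun y hy => ?_)
        nlinarith [mul_le_mul_of_nonneg_left (h y hy) (hφ ((1 / 2 : ℝ) • (y + z)))]
    _ ≤ ∫ y, K * (φ ((1 / 2 : ℝ) • (y + z)) * f ((1 / 2 : ℝ) • (y + z))) :=
        setIntegral_le_integral hI
          (.of_forall fun y => mul_nonneg hK (mul_nonneg (hφ _) (hf _)))
    _ = _ := by
        rw [integral_const_mul, integral_comp_midpoint (fun x => φ x * f x), mul_assoc]

theorem integral_comp_midpoint_mul_le {f φ : EuclideanSpace ℝ (Fin d) → ℝ}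
    (hf : ∀ x, 0 ≤ f x) (hφ : ∀ x, 0 ≤ φ x) (hi : Integrable fun x => φ x * f x)
    {K : ℝ} (hK : 0 ≤ K) (z : EuclideanSpace ℝ (Fin d))
    (h : ∀ y, f y ≤ K * f ((1 / 2 : ℝ) • (y + z))) :
    ∫ y, φ ((1 / 2 : ℝ) • (y + z)) * f y ≤ K * 2 ^ d * ∫ x, φ x * f x := by
  simpa using setIntegral_comp_midpoint_mul_le hf hφ hi MeasurableSet.univ hK z fun y _ => h y

end midpoint

/-! ### Boundedness and decay -/

theorem exists_bound_of_isLogConcave {d : ℕ} {f : EuclideanSpace ℝ (Fin d) → ℝ}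
    (hp : IsProbDensity f) (hf : IsLogConcave f) : ∃ M, ∀ x, f x ≤ M := by
  obtain ⟨h0, hi, h1⟩ := hp
  -- Integrating `√(f z) * √(f y) ≤ f (midpoint)` in `y` would bound `f z`, but `√f` is not yet
  -- known to be integrable; the minimum with `f` is.
  set g : EuclideanSpace ℝ (Fin d) → ℝ := fun x => min (√(f x)) (f x) with hg
  have hg0 : ∀ x, 0 ≤ g x := fun x => le_min (Real.sqrt_nonneg _) (h0 x)
  have hgi : Integrable g := by
    refine hi.mono' ?_ (.of_forall fun x => ?_)
    · exact ((Real.continuous_sqrt.comp_aestronglyMeasurable hi.1).inf hi.1)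
    · rw [Real.norm_of_nonneg (hg0 x)]; exact min_le_right _ _
  have hgpos : 0 < ∫ x, g x := by
    refine lt_of_le_of_ne (integral_nonneg hg0) fun h => ?_
    have h2 := (integral_eq_zero_iff_of_nonneg hg0 hgi).1 h.symm
    have h3 : f =ᵐ[volume] 0 := by
      filter_upwards [h2] with x hx
      by_contra hne
      have : 0 < f x := lt_of_le_of_ne (h0 x) (Ne.symm hne)
      have : 0 < g x := lt_min (Real.sqrt_pos.2 this) this
      exact this.ne' hx
    rw [integral_congr_ae h3] at h1
    simp at h1
  refine ⟨(2 ^ d / ∫ x, g x) ^ 2, fun z => ?_⟩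
  have h2 : √(f z) * ∫ x, g x ≤ 2 ^ d := by
    calc √(f z) * ∫ x, g x = ∫ x, √(f z) * g x := (integral_const_mul _ _).symm
      _ ≤ ∫ y, f ((1 / 2 : ℝ) • (y + z)) := by
        refine integral_mono (hgi.const_mul _) (Integrable.comp_midpoint hi z) fun y => ?_
        calc √(f z) * g y ≤ √(f z) * √(f y) :=
              mul_le_mul_of_nonneg_left (min_le_left _ _) (Real.sqrt_nonneg _)
          _ = √(f y * f z) := by rw [Real.sqrt_mul (h0 y), mul_comm]
          _ ≤ _ := (Real.sqrt_le_left (h0 _)).2 (hf.mul_le_sq_midpoint y z)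
      _ = 2 ^ d := by rw [integral_comp_midpoint, h1, mul_one]
  rw [← Real.sqrt_le_left (by positivity)]
  rwa [le_div_iff₀ hgpos]

/-- The supremum need not be attained, so a maximum up to the factor 2 takes its place. -/
theorem exists_le_two_mul_of_isLogConcave {d : ℕ} {f : EuclideanSpace ℝ (Fin d) → ℝ}
    (hp : IsProbDensity f) (hf : IsLogConcave f) : ∃ x₀, 0 < f x₀ ∧ ∀ y, f y ≤ 2 * f x₀ := by
  obtain ⟨M, hM⟩ := exists_bound_of_isLogConcave hp hf
  have hb : BddAbove (Set.range f) := ⟨M, by rintro _ ⟨x, rfl⟩; exact hM x⟩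
  obtain ⟨x₁, hx₁⟩ : ∃ x, 0 < f x := by
    by_contra! h
    have : f = 0 := funext fun x => le_antisymm (h x) (hp.1 x)
    have h1 := hp.2.2
    simp [this] at h1
  have hs : 0 < ⨆ x, f x := hx₁.trans_le (le_ciSup hb x₁)
  obtain ⟨x₀, h⟩ := exists_lt_of_lt_ciSup (half_lt_self hs)
  exact ⟨x₀, by linarith, fun y => by linarith [le_ciSup hb y]⟩

theorem exp_neg_one_mul_three_ge : 1 ≤ Real.exp (-1) * 3 := by
  rw [Real.exp_neg, inv_mul_eq_div, le_div_iff₀ (Real.exp_pos _)]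
  linarith [Real.exp_one_lt_d9]

theorem exists_radius_of_isLogConcave {d : ℕ} {f : EuclideanSpace ℝ (Fin d) → ℝ}
    (hp : IsProbDensity f) (hf : IsLogConcave f) {x₀ : EuclideanSpace ℝ (Fin d)}
    (hx₀ : ∀ y, f y ≤ 2 * f x₀) :
    ∃ R : ℝ, ∀ z, R ≤ ‖z‖ → f z ≤ Real.exp (-1) * f x₀ := by
  obtain ⟨h0, hi, h1⟩ := hp
  have hlim : Filter.Tendsto (fun n : ℕ => ∫ x in Metric.closedBall 0 (n : ℝ), f x)
      Filter.atTop (nhds (∫ x in ⋃ n : ℕ, Metric.closedBall 0 (n : ℝ), f x)) :=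
    tendsto_setIntegral_of_monotone (fun n => measurableSet_closedBall)
      (fun m n h => Metric.closedBall_subset_closedBall (by exact_mod_cast h)) hi.integrableOn
  rw [Metric.iUnion_closedBall_nat, setIntegral_univ, h1] at hlim
  -- A ball with mass `p` above this threshold violates `p ≤ 3 * 2 ^ d * (1 - p)`, which a distant
  -- point with a large value of `f` would force.
  have hc : (1 : ℝ) - 1 / (3 * 2 ^ d + 2) < 1 := sub_lt_self _ (by positivity)
  obtain ⟨n, hn⟩ := (hlim.eventually_const_lt hc).exists
  -- If `‖y‖ ≤ n` and `‖z‖ ≥ 3n + 1`, the midpoint has norm greater than `n`, so midpoints with `z`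
  -- carry the ball into its complement.
  refine ⟨3 * n + 1, fun z hz => ?_⟩
  by_contra! hlt
  have hB : ∀ y, f y ≤ 3 ^ 2 * f z := fun y => by
    nlinarith [exp_neg_one_mul_three_ge, hx₀ y, h0 x₀]
  set A := Metric.closedBall (0 : EuclideanSpace ℝ (Fin d)) (n : ℝ) with hA
  have hAm : MeasurableSet A := measurableSet_closedBall
  have key := setIntegral_comp_midpoint_mul_le (φ := Aᶜ.indicator 1) h0
    (fun x => Set.indicator_nonneg (fun _ _ => zero_le_one) x)
    (by
      have : (fun x => Aᶜ.indicator 1 x * f x) = Aᶜ.indicator f := by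
        ext x; by_cases hx : x ∈ Aᶜ <;> simp [hx]
      rw [this]; exact hi.indicator hAm.compl) hAm (by norm_num : (0 : ℝ) ≤ 3) z
    fun y _ => hf.le_mul_midpoint (by norm_num) (hB y)
  have e1 : ∫ y in A, Aᶜ.indicator 1 ((1 / 2 : ℝ) • (y + z)) * f y = ∫ y in A, f y := by
    refine setIntegral_congr_fun hAm fun y hy => ?_
    have : (1 / 2 : ℝ) • (y + z) ∈ Aᶜ := by
      simp only [hA, Metric.mem_closedBall, dist_zero_right] at hy
      simp only [hA, Set.mem_compl_iff, Metric.mem_closedBall, dist_zero_right, not_le,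
        norm_smul]
      have : ‖z‖ ≤ ‖y + z‖ + ‖y‖ := by simpa using norm_sub_le (y + z) y
      norm_num
      linarith
    simp only [Set.indicator_of_mem this, Pi.one_apply, one_mul]
  have e2 : ∫ x, Aᶜ.indicator 1 x * f x = 1 - ∫ y in A, f y := by
    have : (fun x => Aᶜ.indicator 1 x * f x) = Aᶜ.indicator f := by
      ext x; by_cases hx : x ∈ Aᶜ <;> simp [hx]
    rw [this, integral_indicator hAm.compl, ← h1, ← integral_add_compl hAm hi]; ring
  rw [e1, e2] at key
  have e3 : (1 / (3 * 2 ^ d + 2) : ℝ) * (3 * 2 ^ d + 2) = 1 := by field_simp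
  nlinarith [show (0 : ℝ) < 2 ^ d by positivity]

theorem sq_mul_exp_neg_le {s : ℝ} (hs : 0 ≤ s) : s ^ 2 * Real.exp (-s) ≤ 2 := by
  rw [Real.exp_neg, ← div_eq_mul_inv, div_le_iff₀ (Real.exp_pos _)]
  linarith [Real.quadratic_le_exp_of_nonneg hs]

/-- Second moment bound for a nonnegative homogeneous function `q` such that `f` has dropped by the
factor `e` where `q (y - x₀) ≥ r`. -/
theorem integral_sq_mul_le_of_drop {d : ℕ} {f : EuclideanSpace ℝ (Fin d) → ℝ}
    (hp : IsProbDensity f) (hf : IsLogConcave f) {q : EuclideanSpace ℝ (Fin d) → ℝ}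
    (hqm : Measurable q) (hq0 : ∀ v, 0 ≤ q v) (hq : ∀ a : ℝ, 0 ≤ a → ∀ v, q (a • v) = a * q v)
    {x₀ : EuclideanSpace ℝ (Fin d)} (hx₀ : 0 < f x₀) {r : ℝ} (hr : 0 < r)
    (h : ∀ v, r ≤ q v → f (x₀ + v) ≤ Real.exp (-1) * f x₀) :
    Integrable (fun y => q (y - x₀) ^ 2 * f y) ∧
      ∫ y, q (y - x₀) ^ 2 * f y ≤ (4 + 8 * 2 ^ d) * r ^ 2 := by
  obtain ⟨h0, hi, h1⟩ := hp
  have hmid := Integrable.comp_midpoint hi x₀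
  have hI : Integrable fun y => 4 * r ^ 2 * f y + 8 * r ^ 2 * f ((1 / 2 : ℝ) • (y + x₀)) :=
    (hi.const_mul _).add (hmid.const_mul _)
  have hle : ∀ y, q (y - x₀) ^ 2 * f y
      ≤ 4 * r ^ 2 * f y + 8 * r ^ 2 * f ((1 / 2 : ℝ) • (y + x₀)) := fun y => by
    set m := (1 / 2 : ℝ) • (y + x₀) with hm
    -- Where `q (y - x₀) ≥ 2r`, the midpoint `m` of `y` and `x₀` is already in the decay region.
    -- This yields `f y ≤ exp (-s) * f m` with `s ≥ 1` proportional to `q (y - x₀)`; the exponential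
    -- absorbs `s²` and the remaining `f m` is integrable.
    rcases le_total (q (y - x₀)) (2 * r) with hle | hge
    · have h2 : q (y - x₀) ^ 2 ≤ (2 * r) ^ 2 := pow_le_pow_left₀ (hq0 _) hle 2
      have := mul_le_mul_of_nonneg_right h2 (h0 y)
      have : 0 ≤ 8 * r ^ 2 * f m := mul_nonneg (by positivity) (h0 m)
      linarith
    · set w := (1 / 2 : ℝ) • (y - x₀) with hw
      have hqw : q (y - x₀) = 2 * q w := by rw [hw, hq _ (by norm_num)]; ring
      have hrw : r ≤ q w := by linarith
      have hqpos : 0 < q w := hr.trans_le hrw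
      set s := q w / r with hs
      have hs1 : 1 ≤ s := (one_le_div hr).2 hrw
      have hmw : m = x₀ + s • (s⁻¹ • w) := by
        rw [smul_smul, mul_inv_cancel₀ (by positivity), one_smul, hm, hw]; module
      have hfm : f m ≤ f x₀ * Real.exp (-s) := by
        rw [hmw]
        refine hf.le_mul_exp_neg hx₀ hs1 (h _ (le_of_eq ?_))
        rw [hq _ (by positivity), hs]; field_simp
      have h2 : f y * f x₀ ≤ f m ^ 2 := hf.mul_le_sq_midpoint y x₀
      have h3 : f y ≤ Real.exp (-s) * f m := by
        refine le_of_mul_le_mul_right (h2.trans ?_) hx₀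
        nlinarith [mul_le_mul_of_nonneg_left hfm (h0 m)]
      have h4 : q (y - x₀) ^ 2 = 4 * r ^ 2 * s ^ 2 := by
        rw [hqw, hs]; field_simp; ring
      have h5 := sq_mul_exp_neg_le (by linarith : 0 ≤ s)
      calc q (y - x₀) ^ 2 * f y ≤ 4 * r ^ 2 * s ^ 2 * (Real.exp (-s) * f m) := by
            rw [h4]; exact mul_le_mul_of_nonneg_left h3 (by positivity)
        _ = 4 * r ^ 2 * f m * (s ^ 2 * Real.exp (-s)) := by ring
        _ ≤ 4 * r ^ 2 * f m * 2 :=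
            mul_le_mul_of_nonneg_left h5 (mul_nonneg (by positivity) (h0 m))
        _ ≤ _ := by
          have : 0 ≤ 4 * r ^ 2 * f y := mul_nonneg (by positivity) (h0 y)
          linarith
  have hnn : ∀ y, 0 ≤ q (y - x₀) ^ 2 * f y := fun y => mul_nonneg (sq_nonneg _) (h0 y)
  refine ⟨hI.mono' ?_ (.of_forall fun y => ?_), ?_⟩
  · exact ((hqm.comp (measurable_id.sub_const x₀)).pow_const 2).aestronglyMeasurable.mul hi.1
  · rw [Real.norm_of_nonneg (hnn y)]; exact hle y
  · calc _ ≤ ∫ y, (4 * r ^ 2 * f y + 8 * r ^ 2 * f ((1 / 2 : ℝ) • (y + x₀))) :=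
          integral_mono_of_nonneg (.of_forall hnn) hI (.of_forall hle)
      _ = _ := by
        rw [integral_add (hi.const_mul _) (hmid.const_mul _), integral_const_mul,
          integral_const_mul, integral_comp_midpoint, h1]
        ring

/-! ### First and second moments -/

section moments
variable {d : ℕ} {f : EuclideanSpace ℝ (Fin d) → ℝ}

theorem integrable_norm_sq_mul (hp : IsProbDensity f) (hf : IsLogConcave f) :
    Integrable fun x => ‖x‖ ^ 2 * f x := by
  obtain ⟨x₀, hx₀, h2⟩ := exists_le_two_mul_of_isLogConcave hp hf
  obtain ⟨R, hR⟩ := exists_radius_of_isLogConcave hp hf h2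
  have h := (integral_sq_mul_le_of_drop hp hf measurable_norm norm_nonneg
    (fun a ha v => by rw [norm_smul, Real.norm_of_nonneg ha]) hx₀
    (r := max R 0 + ‖x₀‖ + 1) (by positivity) fun v hv => hR _ (by
      have : ‖v‖ ≤ ‖x₀ + v‖ + ‖x₀‖ := by simpa using norm_sub_le (x₀ + v) x₀
      linarith [le_max_left R 0])).1
  refine ((h.const_mul 2).add (hp.2.1.const_mul (2 * ‖x₀‖ ^ 2))).mono'
    ((measurable_norm.pow_const 2).aestronglyMeasurable.mul hp.2.1.1) (.of_forall fun x => ?_)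
  rw [Real.norm_of_nonneg (mul_nonneg (sq_nonneg _) (hp.1 x))]
  have h3 : ‖x‖ ≤ ‖x - x₀‖ + ‖x₀‖ := by simpa using norm_add_le (x - x₀) x₀
  have h4 : ‖x‖ ^ 2 ≤ 2 * ‖x - x₀‖ ^ 2 + 2 * ‖x₀‖ ^ 2 := by
    nlinarith [pow_le_pow_left₀ (norm_nonneg x) h3 2, sq_nonneg (‖x - x₀‖ - ‖x₀‖)]
  simp only [Pi.add_apply]
  nlinarith [mul_le_mul_of_nonneg_right h4 (hp.1 x)]

theorem integrable_mul_of_le_one_add_norm_sq (hp : IsProbDensity f) (hf : IsLogConcave f)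
    {φ : EuclideanSpace ℝ (Fin d) → ℝ} (hφ : Continuous φ) {C : ℝ}
    (h : ∀ x, |φ x| ≤ C * (1 + ‖x‖ ^ 2)) : Integrable fun x => φ x * f x := by
  refine ((hp.2.1.add (integrable_norm_sq_mul hp hf)).const_mul C).mono'
    (hφ.aestronglyMeasurable.mul hp.2.1.1) (.of_forall fun x => ?_)
  rw [norm_mul, Real.norm_of_nonneg (hp.1 x), Real.norm_eq_abs]
  simp only [Pi.add_apply]
  nlinarith [mul_le_mul_of_nonneg_right (h x) (hp.1 x)]

theorem abs_inner_le_one_add_norm_sq (u x : EuclideanSpace ℝ (Fin d)) :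
    |inner ℝ x u| ≤ ‖u‖ * (1 + ‖x‖ ^ 2) := by
  have := abs_real_inner_le_norm x u
  nlinarith [sq_nonneg (‖x‖ - 1), norm_nonneg u, norm_nonneg x]

theorem integrable_inner_mul (hp : IsProbDensity f) (hf : IsLogConcave f)
    (u : EuclideanSpace ℝ (Fin d)) : Integrable fun x => inner ℝ x u * f x :=
  integrable_mul_of_le_one_add_norm_sq hp hf (by fun_prop) (abs_inner_le_one_add_norm_sq u)

theorem integrable_abs_inner_mul (hp : IsProbDensity f) (hf : IsLogConcave f)
    (u : EuclideanSpace ℝ (Fin d)) : Integrable fun x => |inner ℝ x u| * f x :=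
  integrable_mul_of_le_one_add_norm_sq hp hf (by fun_prop) fun x => by
    rw [abs_abs]; exact abs_inner_le_one_add_norm_sq u x

theorem integrable_inner_sq_mul (hp : IsProbDensity f) (hf : IsLogConcave f)
    (u : EuclideanSpace ℝ (Fin d)) : Integrable fun x => inner ℝ x u ^ 2 * f x :=
  integrable_mul_of_le_one_add_norm_sq hp hf (C := ‖u‖ ^ 2) (by fun_prop) fun x => by
    rw [abs_of_nonneg (sq_nonneg _), ← sq_abs]
    have := pow_le_pow_left₀ (abs_nonneg _) (abs_real_inner_le_norm x u) 2
    nlinarith [sq_nonneg ‖u‖]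

theorem integrable_coord_mul_coord_mul (hp : IsProbDensity f) (hf : IsLogConcave f)
    (i j : Fin d) : Integrable fun x : EuclideanSpace ℝ (Fin d) => x i * x j * f x :=
  integrable_mul_of_le_one_add_norm_sq hp hf (C := 1) (by fun_prop) fun x => by
    have hi := PiLp.norm_apply_le x i
    have hj := PiLp.norm_apply_le x j
    rw [Real.norm_eq_abs] at hi hj
    rw [abs_mul]
    nlinarith [mul_le_mul hi hj (abs_nonneg _) (norm_nonneg _)]

theorem inner_eq_sum_coord (x u : EuclideanSpace ℝ (Fin d)) :
    inner ℝ x u = ∑ i, u i * x i := by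
  simp [PiLp.inner_apply]

theorem integrable_coord_mul (hp : IsProbDensity f) (hf : IsLogConcave f)
    (i : Fin d) : Integrable fun x : EuclideanSpace ℝ (Fin d) => x i * f x :=
  integrable_mul_of_le_one_add_norm_sq hp hf (C := 1) (by fun_prop) fun x => by
    have hi := PiLp.norm_apply_le x i
    rw [Real.norm_eq_abs] at hi
    nlinarith [sq_nonneg (‖x‖ - 1)]

theorem integral_inner_mul_eq_zero (hp : IsProbDensity f) (hf : IsLogConcave f)
    (hc : IsCentered f) (u : EuclideanSpace ℝ (Fin d)) : ∫ x, inner ℝ x u * f x = 0 := by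
  simp_rw [inner_eq_sum_coord, Finset.sum_mul, mul_assoc]
  rw [integral_finsetSum _ fun i _ => (integrable_coord_mul hp hf i).const_mul _]
  simp [integral_const_mul, hc _]

/-- Otherwise `f` would vanish almost everywhere off the hyperplane orthogonal to `u`, which is
null. -/
theorem integral_abs_inner_mul_pos (hp : IsProbDensity f) (hf : IsLogConcave f)
    {u : EuclideanSpace ℝ (Fin d)} (hu : u ≠ 0) : 0 < ∫ x, |inner ℝ x u| * f x := by
  have h0 : ∀ x, 0 ≤ |inner ℝ x u| * f x := fun x => mul_nonneg (abs_nonneg _) (hp.1 x)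
  refine lt_of_le_of_ne (integral_nonneg h0) fun h => ?_
  have h2 := (integral_eq_zero_iff_of_nonneg h0 (integrable_abs_inner_mul hp hf u)).1 h.symm
  have hker : (innerSL ℝ u).toLinearMap.ker ≠ ⊤ := fun ht => by
    have : u ∈ (innerSL ℝ u).toLinearMap.ker := ht ▸ Submodule.mem_top
    simp [hu] at this
  have hnull := Measure.addHaar_submodule (volume : Measure (EuclideanSpace ℝ (Fin d))) _ hker
  have h3 : f =ᵐ[volume] 0 := by
    filter_upwards [h2, measure_eq_zero_iff_ae_notMem.1 hnull] with x hx hxk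
    rcases mul_eq_zero.1 hx with h | h
    · exact absurd (by simpa [real_inner_comm] using h) hxk
    · exact h
  have h1 := hp.2.2
  rw [integral_congr_ae h3] at h1
  simp at h1

/-- The variance of `|⟪x, u⟫|` is nonnegative. -/
theorem sq_integral_abs_inner_mul_le (hp : IsProbDensity f) (hf : IsLogConcave f)
    (u : EuclideanSpace ℝ (Fin d)) :
    (∫ x, |inner ℝ x u| * f x) ^ 2 ≤ ∫ x, inner ℝ x u ^ 2 * f x := by
  set a := ∫ x, |inner ℝ x u| * f x with ha
  have h : 0 ≤ ∫ x, (inner ℝ x u ^ 2 * f x - 2 * a * (|inner ℝ x u| * f x) + a ^ 2 * f x) :=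
    integral_nonneg fun x => by
      have : 0 ≤ (|inner ℝ x u| - a) ^ 2 * f x := mul_nonneg (sq_nonneg _) (hp.1 x)
      have e : |inner ℝ x u| ^ 2 = inner ℝ x u ^ 2 := sq_abs _
      simp only [Pi.zero_apply]
      rw [← e]; linarith
  have hi1 := integrable_inner_sq_mul hp hf u
  have hi2 := (integrable_abs_inner_mul hp hf u).const_mul (2 * a)
  rw [integral_add (by exact hi1.sub hi2) (hp.2.1.const_mul _), integral_sub hi1 hi2,
    integral_const_mul, integral_const_mul, hp.2.2, ← ha] at h
  nlinarith

/-- By centering, `⟪z, u⟫` is the mean of `⟪y + z, u⟫`, twice the inner product at the midpoint; the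
midpoint transfer bounds its absolute value. -/
theorem abs_inner_le_mul_integral_abs_inner (hp : IsProbDensity f) (hf : IsLogConcave f)
    (hc : IsCentered f) {B : ℝ} (hB : 0 ≤ B) {z : EuclideanSpace ℝ (Fin d)}
    (h : ∀ y, f y ≤ B ^ 2 * f z) (u : EuclideanSpace ℝ (Fin d)) :
    |inner ℝ z u| ≤ 2 * B * 2 ^ d * ∫ x, |inner ℝ x u| * f x := by
  have key := integral_comp_midpoint_mul_le hp.1 (fun x => abs_nonneg (inner ℝ x u))
    (integrable_abs_inner_mul hp hf u) hB z fun y => hf.le_mul_midpoint hB (h y)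
  have e : ∫ y, (inner ℝ y u * f y + inner ℝ z u * f y) = inner ℝ z u := by
    rw [integral_add (integrable_inner_mul hp hf u) (hp.2.1.const_mul _),
      integral_inner_mul_eq_zero hp hf hc, integral_const_mul, hp.2.2]
    ring
  have h2 : |inner ℝ z u| ≤ 2 * ∫ y, |inner ℝ ((1 / 2 : ℝ) • (y + z)) u| * f y := by
    rw [← integral_const_mul]
    calc |inner ℝ z u| = |∫ y, (inner ℝ y u * f y + inner ℝ z u * f y)| := by rw [e]
      _ ≤ ∫ y, |inner ℝ y u * f y + inner ℝ z u * f y| := abs_integral_le_integral_abs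
      _ = _ := integral_congr_ae (.of_forall fun y => by
        simp only
        rw [← add_mul, abs_mul, abs_of_nonneg (hp.1 y), real_inner_smul_left, inner_add_left,
          abs_mul, abs_of_nonneg (by norm_num : (0 : ℝ) ≤ 1 / 2)]
        ring)
  linarith

/-- Mean zero makes the positive and negative parts have equal integrals, so one-sided control
suffices. -/
theorem integral_abs_inner_mul_eq (hp : IsProbDensity f) (hf : IsLogConcave f)
    (hc : IsCentered f) (u : EuclideanSpace ℝ (Fin d)) :
    ∫ x, |inner ℝ x u| * f x = 2 * ∫ x, max (inner ℝ x u) 0 * f x := by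
  have : Integrable fun x => 2 * (max (inner ℝ x u) 0 * f x) :=
    (integrable_mul_of_le_one_add_norm_sq hp hf (by fun_prop) fun x => by
      rw [abs_of_nonneg (le_max_right _ _)]
      exact (max_le (le_abs_self _) (abs_nonneg _)).trans
        (abs_inner_le_one_add_norm_sq u x)).const_mul 2
  have h0 := integral_inner_mul_eq_zero hp hf hc u
  have h1 := integral_sub this (integrable_inner_mul hp hf u)
  rw [h0, sub_zero, integral_const_mul] at h1
  rw [← h1]
  refine integral_congr_ae (.of_forall fun x => ?_)
  simp only
  rcases le_total 0 (inner ℝ x u) with h | h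
  · rw [abs_of_nonneg h, max_eq_left h]; ring
  · rw [abs_of_nonpos h, max_eq_right h]; ring

end moments

/-! ### Separation of a point from a convex set -/

/-- A point outside a nonempty convex set of `ℝ^d` is weakly separated from it. -/
theorem Convex.exists_norm_eq_one_forall_inner_le {d : ℕ} {S : Set (EuclideanSpace ℝ (Fin d))}
    (hS : Convex ℝ S) (hne : S.Nonempty) {x : EuclideanSpace ℝ (Fin d)} (hx : x ∉ S) :
    ∃ u : EuclideanSpace ℝ (Fin d), ‖u‖ = 1 ∧ ∀ y ∈ S, inner ℝ y u ≤ inner ℝ x u := by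
  suffices ∃ u : EuclideanSpace ℝ (Fin d), u ≠ 0 ∧ ∀ y ∈ S, inner ℝ y u ≤ inner ℝ x u by
    obtain ⟨u, hu, h⟩ := this
    refine ⟨‖u‖⁻¹ • u, norm_smul_inv_norm hu, fun y hy => ?_⟩
    rw [real_inner_smul_right, real_inner_smul_right]
    exact mul_le_mul_of_nonneg_left (h y hy) (by positivity)
  by_cases hint : (interior S).Nonempty
  · obtain ⟨g, hg, h⟩ := geometric_hahn_banach_of_nonempty_interior_point hS
      (fun h => hx (interior_subset h)) hint
    refine ⟨(InnerProductSpace.toDual ℝ _).symm g, by simpa using hg, fun y hy => ?_⟩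
    rw [real_inner_comm, real_inner_comm _ x]
    simpa using h y hy
  -- With empty interior the affine span is proper, so some nonzero `u` is constant on `S`; its sign
  -- is chosen to fit `x`.
  · rw [hS.interior_nonempty_iff_affineSpan_eq_top,
      AffineSubspace.affineSpan_eq_top_iff_vectorSpan_eq_top_of_nonempty _ _ _ hne,
      ← Submodule.orthogonal_eq_bot_iff, ← Ne, Submodule.ne_bot_iff] at hint
    obtain ⟨u, hu, hu0⟩ := hint
    obtain ⟨p, hp⟩ := hne
    have hconst : ∀ y ∈ S, inner ℝ y u = inner ℝ p u := fun y hy => by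
      have := (Submodule.mem_orthogonal _ _).1 hu _ (vsub_mem_vectorSpan ℝ hy hp)
      rwa [vsub_eq_sub, inner_sub_left, sub_eq_zero] at this
    rcases le_total (inner ℝ p u) (inner ℝ x u) with h | h
    · exact ⟨u, hu0, fun y hy => (hconst y hy).trans_le h⟩
    · refine ⟨-u, neg_ne_zero.2 hu0, fun y hy => ?_⟩
      rw [inner_neg_right, inner_neg_right, hconst y hy]
      linarith

/-! ### Rayleigh quotient bounds -/

section spectrum
variable {d : ℕ} {A : Matrix (Fin d) (Fin d) ℝ}

open Matrix in
theorem lambdaMin_mul_le_dotProduct_mulVec (hA : A.IsHermitian) (v : Fin d → ℝ) :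
    lambdaMin A * (v ⬝ᵥ v) ≤ v ⬝ᵥ A *ᵥ v := by
  have h : (A - algebraMap ℝ _ (lambdaMin A)).PosSemidef := by
    refine Matrix.posSemidef_iff_isHermitian_and_spectrum_nonneg.2 ⟨hA.sub ?_, ?_⟩
    · rw [Algebra.algebraMap_eq_smul_one]
      simp [Matrix.IsHermitian]
    · rw [← spectrum.sub_singleton_eq]
      rintro _ ⟨a, ha, _, rfl, rfl⟩
      exact sub_nonneg.2 (csInf_le (Matrix.finite_real_spectrum (A := A)).bddBelow ha)
  have := h.dotProduct_mulVec_nonneg v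
  rw [Algebra.algebraMap_eq_smul_one, Matrix.sub_mulVec, Matrix.smul_mulVec, Matrix.one_mulVec,
    dotProduct_sub, dotProduct_smul] at this
  simpa using this

open Matrix in
theorem dotProduct_mulVec_le_lambdaMax_mul (hA : A.IsHermitian) (v : Fin d → ℝ) :
    v ⬝ᵥ A *ᵥ v ≤ lambdaMax A * (v ⬝ᵥ v) := by
  have h : (algebraMap ℝ _ (lambdaMax A) - A).PosSemidef := by
    refine Matrix.posSemidef_iff_isHermitian_and_spectrum_nonneg.2 ⟨Matrix.IsHermitian.sub ?_ hA, ?_⟩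
    · rw [Algebra.algebraMap_eq_smul_one]
      simp [Matrix.IsHermitian]
    · rw [← spectrum.singleton_sub_eq]
      rintro _ ⟨_, rfl, a, ha, rfl⟩
      exact sub_nonneg.2 (le_csSup (Matrix.finite_real_spectrum (A := A)).bddAbove ha)
  have := h.dotProduct_mulVec_nonneg v
  rw [Algebra.algebraMap_eq_smul_one, Matrix.sub_mulVec, Matrix.smul_mulVec, Matrix.one_mulVec,
    dotProduct_sub, dotProduct_smul] at this
  simpa using this

end spectrum

/-! ### The covariance form and directional variances -/

section covariance
variable {d : ℕ} {f : EuclideanSpace ℝ (Fin d) → ℝ}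

theorem covMatrix_apply_of_isCentered (hp : IsProbDensity f) (hc : IsCentered f) (i j : Fin d) :
    covMatrix f i j = ∫ x, x i * x j * f x := by
  simp [covMatrix, hp.2.2, hc i]

theorem covMatrix_isHermitian (f : EuclideanSpace ℝ (Fin d) → ℝ) : (covMatrix f).IsHermitian := by
  ext i j
  simp [covMatrix, mul_comm]

open Matrix in
theorem dotProduct_covMatrix_mulVec (hp : IsProbDensity f) (hf : IsLogConcave f)
    (hc : IsCentered f) (u : EuclideanSpace ℝ (Fin d)) :
    (u : Fin d → ℝ) ⬝ᵥ covMatrix f *ᵥ u = ∫ x, inner ℝ x u ^ 2 * f x := by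
  have e : ∀ x : EuclideanSpace ℝ (Fin d), inner ℝ x u ^ 2 * f x
      = ∑ i, ∑ j, u i * u j * (x i * x j * f x) := fun x => by
    rw [inner_eq_sum_coord, sq, Finset.sum_mul_sum, Finset.sum_mul]
    refine Finset.sum_congr rfl fun i _ => ?_
    rw [Finset.sum_mul]
    exact Finset.sum_congr rfl fun j _ => by ring
  have hi := integrable_coord_mul_coord_mul hp hf
  simp_rw [e]
  rw [integral_finsetSum _ fun i _ => integrable_finsetSum _ fun j _ => (hi i j).const_mul _]
  refine Finset.sum_congr rfl fun i _ => ?_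
  rw [integral_finsetSum _ fun j _ => (hi i j).const_mul _, Matrix.mulVec, dotProduct,
    Finset.mul_sum]
  refine Finset.sum_congr rfl fun j _ => ?_
  rw [integral_const_mul, covMatrix_apply_of_isCentered hp hc]
  ring

theorem dotProduct_self_of_norm_eq_one {u : EuclideanSpace ℝ (Fin d)} (hu : ‖u‖ = 1) :
    (u : Fin d → ℝ) ⬝ᵥ u = 1 := by
  have h := real_inner_self_eq_norm_sq u
  rw [inner_eq_sum_coord, hu, one_pow] at h
  exact h

theorem lambdaMin_covMatrix_le (hp : IsProbDensity f) (hf : IsLogConcave f)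
    (hc : IsCentered f) {u : EuclideanSpace ℝ (Fin d)} (hu : ‖u‖ = 1) :
    lambdaMin (covMatrix f) ≤ ∫ x, inner ℝ x u ^ 2 * f x := by
  have := lambdaMin_mul_le_dotProduct_mulVec (covMatrix_isHermitian f) u
  rwa [dotProduct_covMatrix_mulVec hp hf hc, dotProduct_self_of_norm_eq_one hu, mul_one] at this

theorem le_lambdaMax_covMatrix (hp : IsProbDensity f) (hf : IsLogConcave f)
    (hc : IsCentered f) {u : EuclideanSpace ℝ (Fin d)} (hu : ‖u‖ = 1) :
    ∫ x, inner ℝ x u ^ 2 * f x ≤ lambdaMax (covMatrix f) := by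
  have := dotProduct_mulVec_le_lambdaMax_mul (covMatrix_isHermitian f) u
  rwa [dotProduct_covMatrix_mulVec hp hf hc, dotProduct_self_of_norm_eq_one hu, mul_one] at this

end covariance

/-! ### Centered densities: value at the barycenter, level sets, rays -/

section centered
variable {d : ℕ} {f : EuclideanSpace ℝ (Fin d) → ℝ}

/-- The value of a centered log-concave density at its barycenter is comparable to its maximum. -/
theorem le_mul_apply_zero_of_isCentered (hp : IsProbDensity f) (hf : IsLogConcave f)
    (hc : IsCentered f) (y : EuclideanSpace ℝ (Fin d)) : f y ≤ 2 * (32 * 4 ^ d) ^ 2 * f 0 := by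
  obtain ⟨x₀, hx₀, h2⟩ := exists_le_two_mul_of_isLogConcave hp hf
  -- Chosen so that the half moment `I / 2` is finally bounded by `(2/32 + 4/32) * I`, which is
  -- impossible.
  set N : ℝ := 32 * 4 ^ d with hN
  have hN1 : 1 ≤ N := by
    have : (1 : ℝ) ≤ 4 ^ d := one_le_pow₀ (by norm_num)
    linarith
  have hN0 : 0 < N := by linarith
  suffices h : f x₀ ≤ N ^ 2 * f 0 by linarith [h2 y]
  by_contra! hlt
  set a : ℝ := (N⁻¹) ^ 2 * f x₀ with ha
  have ha0 : 0 < a := by positivity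
  have h0a : f 0 < a := by
    rw [ha, inv_pow, inv_mul_eq_div, lt_div_iff₀ (by positivity)]; linarith
  have hx₀T : a ≤ f x₀ := by
    rw [ha]
    exact mul_le_of_le_one_left hx₀.le (pow_le_one₀ (by positivity) (inv_le_one_of_one_le₀ hN1))
  obtain ⟨u, hu, hsep⟩ := (hf.convex_superlevel ha0).exists_norm_eq_one_forall_inner_le
    ⟨x₀, hx₀T⟩ (x := 0) (by simpa using h0a)
  simp only [Set.mem_ofPred_eq, inner_zero_left] at hsep
  set A : Set (EuclideanSpace ℝ (Fin d)) := {x | 0 < inner ℝ x u} with hA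
  have hAm : MeasurableSet A := measurableSet_lt measurable_const (by fun_prop)
  -- On the open half-space `A` the value of `f` is below `N⁻² f x₀`, so both the mass of `A` and
  -- its recentred first moment gain a factor `N⁻¹`.
  have hcontr : ∀ y ∈ A, f y ≤ N⁻¹ * f ((1 / 2 : ℝ) • (y + x₀)) := fun y hy =>
    hf.le_mul_midpoint (by positivity) (by
      by_contra! hya
      exact absurd (hsep y hya.le) (not_le.2 hy))
  set I := ∫ x, |inner ℝ x u| * f x with hI
  have hIi := integrable_abs_inner_mul hp hf u
  have hIpos : 0 < I := integral_abs_inner_mul_pos hp hf (by rintro rfl; simp at hu)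
  have k1 := setIntegral_comp_midpoint_mul_le hp.1 (fun x => abs_nonneg (inner ℝ x u)) hIi hAm
    (by positivity) x₀ hcontr
  have k2 := setIntegral_comp_midpoint_mul_le (φ := fun _ => 1) hp.1 (fun _ => zero_le_one)
    (by simpa using hp.2.1) hAm (by positivity) x₀ hcontr
  simp only [one_mul, hp.2.2, mul_one] at k2
  have ht : |inner ℝ x₀ u| ≤ 2 * 2 * 2 ^ d * I :=
    abs_inner_le_mul_integral_abs_inner hp hf hc (by norm_num)
      (fun y => by linarith [h2 y]) u
  set t := |inner ℝ x₀ u| with htdef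
  have hmidi : Integrable fun y => |inner ℝ ((1 / 2 : ℝ) • (y + x₀)) u| * f y := by
    refine integrable_mul_of_le_one_add_norm_sq hp hf (C := ‖u‖ + t) (by fun_prop) fun y => ?_
    rw [abs_abs, real_inner_smul_left, inner_add_left, abs_mul]
    have h3 := abs_inner_le_one_add_norm_sq u y
    have h4 := abs_add_le (inner ℝ y u) (inner ℝ x₀ u)
    rw [abs_of_nonneg (by norm_num : (0 : ℝ) ≤ 1 / 2)]
    nlinarith [abs_nonneg (inner ℝ x₀ u), abs_nonneg (inner ℝ y u), sq_nonneg ‖y‖]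
  -- By centering, `A` carries half of the first absolute moment.
  have k3 : I / 2 ≤ 2 * (∫ y in A, |inner ℝ ((1 / 2 : ℝ) • (y + x₀)) u| * f y)
      + t * ∫ y in A, f y := by
    have e : I / 2 = ∫ y in A, inner ℝ y u * f y := by
      rw [hI, integral_abs_inner_mul_eq hp hf hc, mul_div_cancel_left₀ _ two_ne_zero,
        ← integral_indicator hAm]
      refine integral_congr_ae (.of_forall fun x => ?_)
      by_cases hx : x ∈ A
      · simp [hx, max_eq_left (show (0 : ℝ) ≤ inner ℝ x u from le_of_lt hx)]
      · simp [hx, max_eq_right (show inner ℝ x u ≤ (0 : ℝ) from not_lt.1 hx)]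
    rw [e, ← integral_const_mul, ← integral_const_mul,
      ← integral_add (hmidi.integrableOn.const_mul _) (hp.2.1.integrableOn.const_mul _)]
    refine integral_mono (integrable_inner_mul hp hf u).integrableOn
      ((hmidi.integrableOn.const_mul _).add (hp.2.1.integrableOn.const_mul _)) fun y => ?_
    simp only
    have h3 : inner ℝ y u ≤ 2 * |inner ℝ ((1 / 2 : ℝ) • (y + x₀)) u| + t := by
      rw [real_inner_smul_left, inner_add_left, abs_mul,
        abs_of_nonneg (by norm_num : (0 : ℝ) ≤ 1 / 2)]
      linarith [le_abs_self (inner ℝ y u + inner ℝ x₀ u), neg_abs_le (inner ℝ x₀ u)]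
    linarith [mul_le_mul_of_nonneg_right h3 (hp.1 y)]
  have hp2 : (1 : ℝ) ≤ 2 ^ d := one_le_pow₀ (by norm_num)
  have h4 : (4 : ℝ) ^ d = 2 ^ d * 2 ^ d := by rw [← mul_pow]; norm_num
  have k4 : t * ∫ y in A, f y ≤ 2 * 2 * 2 ^ d * I * (N⁻¹ * 2 ^ d) :=
    mul_le_mul ht k2 (setIntegral_nonneg hAm fun y _ => hp.1 y) (by positivity)
  have k5 : N⁻¹ * (2 ^ d * 2 ^ d) = 1 / 32 := by
    rw [← h4, hN]; field_simp
  have k6 : N⁻¹ * 2 ^ d ≤ 1 / 32 := by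
    rw [← k5]; exact mul_le_mul_of_nonneg_left (by nlinarith) (by positivity)
  have k7 := mul_le_mul_of_nonneg_right k6 hIpos.le
  have k8 : 2 * 2 * 2 ^ d * I * (N⁻¹ * 2 ^ d) = 4 * (1 / 32) * I := by rw [← k5]; ring
  linarith

theorem apply_zero_pos_of_isCentered (hp : IsProbDensity f) (hf : IsLogConcave f)
    (hc : IsCentered f) : 0 < f 0 := by
  obtain ⟨x₀, hx₀, -⟩ := exists_le_two_mul_of_isLogConcave hp hf
  exact pos_of_mul_pos_right (hx₀.trans_le (le_mul_apply_zero_of_isCentered hp hf hc x₀))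
    (by positivity)

theorem abs_inner_le_of_exp_neg_one_mul_le (hp : IsProbDensity f) (hf : IsLogConcave f)
    (hc : IsCentered f) {z : EuclideanSpace ℝ (Fin d)} (hz : Real.exp (-1) * f 0 ≤ f z)
    (u : EuclideanSpace ℝ (Fin d)) :
    |inner ℝ z u| ≤ 192 * 8 ^ d * ∫ x, |inner ℝ x u| * f x := by
  -- With `e ≤ 3`, `f y ≤ 6 * (32 * 4 ^ d) ^ 2 * f z`, and `6 ≤ 3²` gives `B = 3 * 32 * 4 ^ d`.
  have h := abs_inner_le_mul_integral_abs_inner hp hf hc (B := 96 * 4 ^ d) (by positivity)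
    (z := z) (fun y => by
      have h1 := le_mul_apply_zero_of_isCentered hp hf hc y
      have h2 : f 0 ≤ 3 * f z := by
        nlinarith [exp_neg_one_mul_three_ge, hp.1 0]
      have h3 : (0 : ℝ) ≤ (4 ^ d) ^ 2 := by positivity
      have h4 := mul_le_mul_of_nonneg_left h2 h3
      nlinarith [mul_nonneg h3 (hp.1 z)]) u
  have e : (8 : ℝ) ^ d = 4 ^ d * 2 ^ d := by rw [← mul_pow]; norm_num
  rw [e]
  linarith

theorem abs_inner_le_mul_sqrt_lambdaMax (hp : IsProbDensity f) (hf : IsLogConcave f)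
    (hc : IsCentered f) {z : EuclideanSpace ℝ (Fin d)} (hz : Real.exp (-1) * f 0 ≤ f z)
    {u : EuclideanSpace ℝ (Fin d)} (hu : ‖u‖ = 1) :
    |inner ℝ z u| ≤ 192 * 8 ^ d * √(lambdaMax (covMatrix f)) := by
  refine (abs_inner_le_of_exp_neg_one_mul_le hp hf hc hz u).trans
    (mul_le_mul_of_nonneg_left (Real.le_sqrt_of_sq_le ?_) (by positivity))
  exact (sq_integral_abs_inner_mul_le hp hf u).trans (le_lambdaMax_covMatrix hp hf hc hu)

theorem lambdaMax_covMatrix_pos (hp : IsProbDensity f) (hf : IsLogConcave f)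
    (hc : IsCentered f) {u : EuclideanSpace ℝ (Fin d)} (hu : ‖u‖ = 1) :
    0 < lambdaMax (covMatrix f) := by
  have h := integral_abs_inner_mul_pos hp hf (u := u) (by rintro rfl; simp at hu)
  exact (pow_pos h 2).trans_le
    ((sq_integral_abs_inner_mul_le hp hf u).trans (le_lambdaMax_covMatrix hp hf hc hu))

/-- If `f` drops by the factor `e` on the half-space `⟪·, u⟫ ≥ r`, then the standard deviation
in the direction `u` is at most a constant times `r`. -/
theorem integral_inner_sq_mul_le_of_drop (hp : IsProbDensity f) (hf : IsLogConcave f)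
    (hc : IsCentered f) (u : EuclideanSpace ℝ (Fin d)) {r : ℝ} (hr : 0 < r)
    (h : ∀ v, r ≤ inner ℝ v u → f v ≤ Real.exp (-1) * f 0) :
    ∫ x, inner ℝ x u ^ 2 * f x
      ≤ (4 + 8 * 2 ^ d) * (2 * (192 * 8 ^ d * (2 * √((4 + 8 * 2 ^ d) * r ^ 2)))) ^ 2 := by
  have hf0 := apply_zero_pos_of_isCentered hp hf hc
  -- First the one-sided functional bounds the positive part. Centering then bounds the full first
  -- moment, which confines the level set on both sides of the hyperplane; a second application with
  -- `|⟪·, u⟫|` bounds the variance.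
  have hpos := integral_sq_mul_le_of_drop hp hf (q := fun v => max (inner ℝ v u) 0)
    (by fun_prop) (fun v => le_max_right _ _)
    (fun a ha v => by
      rw [real_inner_smul_left, mul_max_of_nonneg _ _ ha, mul_zero]) hf0 hr
    (fun v hv => by
      rw [zero_add]
      rcases le_max_iff.1 hv with h1 | h1
      · exact h v h1
      · exact absurd h1 (not_le.2 hr))
  simp only [sub_zero] at hpos
  obtain ⟨hi, hle⟩ := hpos
  set m := ∫ x, max (inner ℝ x u) 0 * f x with hm
  have hmi : Integrable fun x => max (inner ℝ x u) 0 * f x :=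
    integrable_mul_of_le_one_add_norm_sq hp hf (by fun_prop) fun x => by
      rw [abs_of_nonneg (le_max_right _ _)]
      exact (max_le (le_abs_self _) (abs_nonneg _)).trans (abs_inner_le_one_add_norm_sq u x)
  have hcs : m ^ 2 ≤ ∫ x, max (inner ℝ x u) 0 ^ 2 * f x := by
    have h3 : 0 ≤ ∫ x, (max (inner ℝ x u) 0 ^ 2 * f x - 2 * m * (max (inner ℝ x u) 0 * f x)
        + m ^ 2 * f x) := integral_nonneg fun x => by
      have : 0 ≤ (max (inner ℝ x u) 0 - m) ^ 2 * f x := mul_nonneg (sq_nonneg _) (hp.1 x)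
      simp only [Pi.zero_apply]
      linarith
    rw [integral_add (by exact hi.sub (hmi.const_mul (2 * m))) (hp.2.1.const_mul _),
      integral_sub hi (hmi.const_mul (2 * m)), integral_const_mul, integral_const_mul, hp.2.2,
      ← hm] at h3
    nlinarith
  have hmle : m ≤ √((4 + 8 * 2 ^ d) * r ^ 2) := Real.le_sqrt_of_sq_le (hcs.trans hle)
  have hrad : ∀ z, Real.exp (-1) * f 0 ≤ f z →
      |inner ℝ z u| ≤ 192 * 8 ^ d * (2 * √((4 + 8 * 2 ^ d) * r ^ 2)) := fun z hz => by
    refine (abs_inner_le_of_exp_neg_one_mul_le hp hf hc hz u).trans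
      (mul_le_mul_of_nonneg_left ?_ (by positivity))
    rw [integral_abs_inner_mul_eq hp hf hc]
    linarith
  set ρ := 192 * 8 ^ d * (2 * √((4 + 8 * 2 ^ d) * r ^ 2)) with hρ
  have hρ0 : 0 < ρ := by positivity
  have := (integral_sq_mul_le_of_drop hp hf (q := fun v => |inner ℝ v u|)
    (by fun_prop) (fun v => abs_nonneg _)
    (fun a ha v => by rw [real_inner_smul_left, abs_mul, abs_of_nonneg ha]) hf0
    (r := 2 * ρ) (by positivity)
    (fun v hv => by
      rw [zero_add]
      by_contra! hlt
      linarith [hrad v hlt.le])).2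
  simpa only [sub_zero, sq_abs] using this

theorem exp_neg_one_mul_le_of_le_sqrt_lambdaMin (hp : IsProbDensity f) (hf : IsLogConcave f)
    (hc : IsCentered f) {x : EuclideanSpace ℝ (Fin d)}
    (hx : ‖x‖ < √(lambdaMin (covMatrix f)) / (1536 * 8 ^ d * (4 + 8 * 2 ^ d))) :
    Real.exp (-1) * f 0 ≤ f x := by
  by_contra! hlt
  have hf0 := apply_zero_pos_of_isCentered hp hf hc
  have h0 : Real.exp (-1) * f 0 ≤ f 0 :=
    mul_le_of_le_one_left hf0.le (Real.exp_le_one_iff.2 (by norm_num))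
  obtain ⟨u, hu, hsep⟩ := (hf.convex_superlevel (a := Real.exp (-1) * f 0)
    (by positivity)).exists_norm_eq_one_forall_inner_le ⟨0, h0⟩ (x := x) (by simpa using hlt)
  have hx0 : 0 < ‖x‖ := norm_pos_iff.2 (by rintro rfl; exact absurd h0 (not_le.2 hlt))
  have hxu : inner ℝ x u ≤ ‖x‖ := by simpa [hu] using real_inner_le_norm x u
  have h1 := (lambdaMin_covMatrix_le hp hf hc hu).trans
    -- Separation only gives `⟪v, u⟫ ≤ ‖x‖` on the level set; doubling the radius makes the
    -- exclusion strict.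
    (integral_inner_sq_mul_le_of_drop hp hf hc u (r := 2 * ‖x‖) (by positivity) fun v hv => by
      by_contra! hv2
      linarith [hsep v hv2.le])
  set K : ℝ := 4 + 8 * 2 ^ d with hK
  have hK0 : 0 < K := by positivity
  rw [lt_div_iff₀ (by positivity)] at hx
  have h2 : √(lambdaMin (covMatrix f)) ≤ ‖x‖ * (1536 * 8 ^ d * K) := by
    refine Real.sqrt_le_iff.2 ⟨by positivity, h1.trans (le_of_eq ?_)⟩
    have e := Real.sq_sqrt (show 0 ≤ K * (2 * ‖x‖) ^ 2 by positivity)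
    calc _ = K * (768 * 8 ^ d) ^ 2 * √(K * (2 * ‖x‖) ^ 2) ^ 2 := by ring
      _ = _ := by rw [e]; ring
  linarith

/-- Integrability on `ℝ^d` gives no measurability on a line, which may be a null set; here it comes
from the superlevel sets along the line being intervals. -/
theorem measurable_comp_smul_of_isLogConcave (hf : IsLogConcave f)
    (θ : EuclideanSpace ℝ (Fin d)) : Measurable fun r : ℝ => f (r • θ) := by
  refine measurable_of_Ici fun a => ?_
  rcases le_or_gt a 0 with ha | ha
  · convert MeasurableSet.univ
    exact Set.eq_univ_of_forall fun r => ha.trans (hf.1 _)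
  · have := (hf.convex_superlevel ha).linear_preimage ((LinearMap.id : ℝ →ₗ[ℝ] ℝ).smulRight θ)
    exact this.ordConnected.measurableSet

theorem apply_smul_le_mul_exp (hp : IsProbDensity f) (hf : IsLogConcave f)
    (hc : IsCentered f) {θ : EuclideanSpace ℝ (Fin d)} (hθ : ‖θ‖ = 1) (r : ℝ) :
    f (r • θ) ≤ 6 * (32 * 4 ^ d) ^ 2 * f 0 *
      Real.exp (-((384 * 8 ^ d * √(lambdaMax (covMatrix f)))⁻¹ * r)) := by
  have hf0 := apply_zero_pos_of_isCentered hp hf hc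
  have hσ := Real.sqrt_pos.2 (lambdaMax_covMatrix_pos hp hf hc hθ)
  set σ := √(lambdaMax (covMatrix f)) with hσd
  set R : ℝ := 384 * 8 ^ d * σ with hR
  have hR0 : 0 < R := by positivity
  set N : ℝ := 32 * 4 ^ d with hN
  have hN1 : 1 ≤ N := by
    have : (1 : ℝ) ≤ 4 ^ d := one_le_pow₀ (by norm_num)
    linarith
  rw [inv_mul_eq_div]
  -- Up to `R`, twice the level-set radius, the global bound is used and the exponential costs only
  -- a factor 3; beyond `R` the decay is genuine.
  rcases le_total r R with h | h
  · have h1 := le_mul_apply_zero_of_isCentered hp hf hc (r • θ)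
    have h2 : Real.exp (-1) ≤ Real.exp (-(r / R)) :=
      Real.exp_le_exp.2 (neg_le_neg ((div_le_one hR0).2 h))
    have h3 : 1 ≤ 3 * Real.exp (-(r / R)) := by linarith [exp_neg_one_mul_three_ge]
    have h4 : 0 ≤ 2 * N ^ 2 * f 0 := by positivity
    calc f (r • θ) ≤ 2 * N ^ 2 * f 0 := h1
      _ ≤ 2 * N ^ 2 * f 0 * (3 * Real.exp (-(r / R))) := le_mul_of_one_le_right h4 h3
      _ = _ := by ring
  · have hdrop : f (0 + R • θ) ≤ Real.exp (-1) * f 0 := by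
      rw [zero_add]
      by_contra! hlt
      have h1 := abs_inner_le_mul_sqrt_lambdaMax hp hf hc hlt.le hθ
      rw [real_inner_smul_left, real_inner_self_eq_norm_sq, hθ, one_pow, mul_one,
        abs_of_pos hR0] at h1
      have : 0 < 8 ^ d * σ := by positivity
      linarith
    have h1 := hf.le_mul_exp_neg hf0 ((one_le_div hR0).2 h) hdrop
    rw [zero_add, smul_smul, div_mul_cancel₀ _ hR0.ne'] at h1
    refine h1.trans (mul_le_mul_of_nonneg_right ?_ (Real.exp_nonneg _))
    exact le_mul_of_one_le_left hf0.le (by nlinarith)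

end centered

/-! ### Radial integrals and the theorem -/

theorem integrableOn_pow_mul_exp_neg_mul (n : ℕ) {b : ℝ} (hb : 0 < b) :
    IntegrableOn (fun r : ℝ => r ^ n * Real.exp (-(b * r))) (Set.Ioi 0) := by
  have := integrableOn_rpow_mul_exp_neg_mul_rpow (s := n) (p := 1) (b := b)
    (by linarith [n.cast_nonneg (α := ℝ)]) one_pos hb
  refine this.congr_fun (fun r _ => ?_) measurableSet_Ioi
  simp

theorem integral_pow_mul_exp_neg_mul (n : ℕ) {b : ℝ} (hb : 0 < b) :
    ∫ r in Set.Ioi (0 : ℝ), r ^ n * Real.exp (-(b * r)) = n.factorial * b⁻¹ ^ (n + 1) := by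
  have := Real.integral_rpow_mul_exp_neg_mul_Ioi (a := n + 1) (r := b) (by positivity) hb
  rw [Real.Gamma_nat_eq_factorial, add_sub_cancel_right] at this
  simp only [Real.rpow_natCast] at this
  rw [this, mul_comm, one_div]
  norm_cast

theorem mainTheorem8 (d : ℕ) (hd : 1 ≤ d) :
    ∃ c C : ℝ, 0 < c ∧ 0 < C ∧
      ∀ f : EuclideanSpace ℝ (Fin d) → ℝ,
        IsProbDensity f → IsLogConcave f → IsCentered f →
          Integrable (fun x : EuclideanSpace ℝ (Fin d) => ‖x‖ ^ 2 * f x) ∧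
          ∀ θ : EuclideanSpace ℝ (Fin d), ‖θ‖ = 1 →
            IntegrableOn (fun r : ℝ => r ^ (d - 1) * f (r • θ)) (Set.Ioi 0) ∧
            c * (f 0 * Real.sqrt (lambdaMin (covMatrix f)) ^ d)
              ≤ ∫ r in Set.Ioi (0 : ℝ), r ^ (d - 1) * f (r • θ) ∧
            ∫ r in Set.Ioi (0 : ℝ), r ^ (d - 1) * f (r • θ)
              ≤ C * (f 0 * Real.sqrt (lambdaMax (covMatrix f)) ^ d) := by
  have hd1 : d - 1 + 1 = d := Nat.sub_add_cancel hd
  -- The lower constant integrates `r ^ (d - 1) * f 0 / e` over `(0, ρ)`, giving `ρ ^ d / d`; the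
  -- upper one comes from the Gamma integral `(d - 1)! * b⁻¹ ^ d`.
  refine ⟨Real.exp (-1) / d * (1 / (1536 * 8 ^ d * (4 + 8 * 2 ^ d))) ^ d,
    6 * (32 * 4 ^ d) ^ 2 * (d - 1).factorial * (384 * 8 ^ d) ^ d, by positivity, by positivity,
    fun f hp hf hc => ⟨integrable_norm_sq_mul hp hf, fun θ hθ => ?_⟩⟩
  have hf0 := apply_zero_pos_of_isCentered hp hf hc
  have hσ := Real.sqrt_pos.2 (lambdaMax_covMatrix_pos hp hf hc hθ)
  set b : ℝ := (384 * 8 ^ d * √(lambdaMax (covMatrix f)))⁻¹ with hb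
  have hb0 : 0 < b := by positivity
  set M : ℝ := 6 * (32 * 4 ^ d) ^ 2 * f 0 with hM
  have hdom : IntegrableOn (fun r : ℝ => M * (r ^ (d - 1) * Real.exp (-(b * r)))) (Set.Ioi 0) :=
    (integrableOn_pow_mul_exp_neg_mul (d - 1) hb0).const_mul M
  have hle : ∀ r ∈ Set.Ioi (0 : ℝ),
      r ^ (d - 1) * f (r • θ) ≤ M * (r ^ (d - 1) * Real.exp (-(b * r))) := fun r hr => by
    have := mul_le_mul_of_nonneg_left (apply_smul_le_mul_exp hp hf hc hθ r)
      (pow_nonneg (le_of_lt hr) (d - 1))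
    linarith
  have hnn : ∀ r ∈ Set.Ioi (0 : ℝ), 0 ≤ r ^ (d - 1) * f (r • θ) := fun r hr =>
    mul_nonneg (pow_nonneg (le_of_lt hr) _) (hp.1 _)
  have hint : IntegrableOn (fun r : ℝ => r ^ (d - 1) * f (r • θ)) (Set.Ioi 0) := by
    refine Integrable.mono' hdom ((measurable_id.pow_const _).mul
      (measurable_comp_smul_of_isLogConcave hf θ)).aestronglyMeasurable ?_
    refine (ae_restrict_iff' measurableSet_Ioi).2 (.of_forall fun r hr => ?_)
    rw [Real.norm_of_nonneg (hnn r hr)]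
    exact hle r hr
  refine ⟨hint, ?_, ?_⟩
  · set ρ := √(lambdaMin (covMatrix f)) / (1536 * 8 ^ d * (4 + 8 * 2 ^ d)) with hρ
    have hρ0 : 0 ≤ ρ := by positivity
    have hsub : Set.Ioo 0 ρ ⊆ Set.Ioi (0 : ℝ) := Set.Ioo_subset_Ioi_self
    calc _ = Real.exp (-1) * f 0 * (ρ ^ (d - 1 + 1) / ((d - 1 : ℕ) + 1)) := by
          rw [hd1, Nat.cast_sub hd, Nat.cast_one, sub_add_cancel, hρ, div_pow, div_pow]
          ring
      _ = ∫ r in Set.Ioo 0 ρ, Real.exp (-1) * f 0 * r ^ (d - 1) := by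
          rw [← integral_Ioc_eq_integral_Ioo, ← intervalIntegral.integral_of_le hρ0,
            intervalIntegral.integral_const_mul, integral_pow]
          simp
      _ ≤ ∫ r in Set.Ioo 0 ρ, r ^ (d - 1) * f (r • θ) := by
          refine setIntegral_mono_on ?_ (hint.mono_set hsub) measurableSet_Ioo fun r hr => ?_
          · exact ((by fun_prop : Continuous fun r : ℝ => Real.exp (-1) * f 0 * r ^ (d - 1)
              ).integrableOn_Icc).mono_set Set.Ioo_subset_Icc_self
          · rw [mul_comm]
            refine mul_le_mul_of_nonneg_left ?_ (pow_nonneg hr.1.le _)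
            refine exp_neg_one_mul_le_of_le_sqrt_lambdaMin hp hf hc ?_
            rw [norm_smul, hθ, mul_one, Real.norm_of_nonneg hr.1.le]
            exact hr.2
      _ ≤ _ := setIntegral_mono_set hint
          ((ae_restrict_iff' measurableSet_Ioi).2 (.of_forall hnn)) hsub.eventuallyLE
  · calc _ ≤ ∫ r in Set.Ioi (0 : ℝ), M * (r ^ (d - 1) * Real.exp (-(b * r))) :=
          setIntegral_mono_on hint hdom measurableSet_Ioi hle
      _ = _ := by
          rw [integral_const_mul, integral_pow_mul_exp_neg_mul _ hb0, hd1, hb, inv_inv, hM,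
            mul_pow]
          ring
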